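/- **Definitions.** For probability measures $P,Q$ on a measurable space let $$T(P,Q)(\alpha)=\inf\{1-\mathbb{E}_Q\phi \;:\; \phi \text{ measurable with values in } [0,1],\ \mathbb{E}_P\phi\le 1-\alpha\},\qquad \alpha\in[0,1],$$ and write $T(X,Y)$ for random variables $X,Y$ to mean $T$ of their laws. A function $f:[0,1]\to[0,1]$ is a *tradeoff function* if $f=T(P,Q)$ for some $P,Q$; it is *symmetric* if $f=T(P,Q)$ implies $f=T(Q,P)$, and *nontrivial* if $f(\alpha)<\alpha$ for some $\alpha\in(0,1)$. A collection $\{f_t\mid t\ge 0\}$ of symmetric tradeoff functions is *infinitely divisible* if $f_s\circ f_t=f_{s+t}$ for all $s,t\ge0$, $f_s$ is nontrivial for all $s>0$, and $f_s\to f_0=\mathrm{Id}$ pointwise on $[0,1]$ as $s\downarrow0$. A real random variable $N$ with continuous cdf $F$ is a *canonical noise distribution* (CND) for a symmetric tradeoff function $f$ if: $T(N,N+m)\ge f$ on $[0,1]$ for all $m\in[0,1]$; $f(\alpha)=T(N,N+1)(\alpha)=F(F^{-1}(\alpha)-1)$ for all $\alpha\in(0,1)$, where $F^{-1}(\alpha)=\inf\{x: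 F(x)\ge\alpha\}$; and $F(x)=1-F(-x)$ for all $x\in\mathbb{R}$. It is *log-concave* if it has a density $e^{C}$ with $C:\mathbb{R}\to[-\infty,\infty)$ concave. For a symmetric nontrivial tradeoff function $f$ let $c_f$ be the unique $c\in[0,1]$ with $f(1-c)=c$, and let $F_f:\mathbb{R}\to\mathbb{R}$ be the function with $F_f(x)=c_f(\tfrac12-x)+(1-c_f)(x+\tfrac12)$ for $|x|\le\tfrac12$, $F_f(x)=f(F_f(x+1))$ for $x<-\tfrac12$, and $F_f(x)=1-f(1-F_f(x-1))$ for $x>\tfrac12$. The *log-concave CND of an infinitely divisible collection* $\{f_t\}$ is the log-concave CND for $f_1$ whose cdf is $F(x)=\lim_{s\downarrow0}F_{f_s}(x/s)$ for all $x\in\mathbb{R}$. **Theorem.** Let $\{f_t\mid t\ge0\}$ be an infinitely divisible collection of symmetric tradeoff functions, let $N$ be a random variable whose law is the log-concave CND of this collection, and let $N'$ be any real random variable such that $T(N',N'+t)\ge f_t$ on $[0,1]$ for all $t\ge0$. Then for every $a\in\mathbb{R}$, $|N'-a|$ stochastically dominates $|N|$, i.e. the cdf of $|N'-a|$ is at most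 the cdf of $|N|$ at every point of $\mathbb{R}$. Moreover: 1. $P(|N|\le t)\ge P(|N'-a|\le t)$ for all $a\in\mathbb{R}$ and all real $t\ge0$. 2. For every non-decreasing function $\phi:[0,\infty)\to\mathbb{R}$ and every $a\in\mathbb{R}$, $\mathbb{E}\,\phi(|N|)\le\mathbb{E}\,\phi(|N'-a|)$ as expectations in $(-\infty,\infty]$; in particular, if $\phi(|N'-a|)$ is integrable then so is $\phi(|N|)$. 3. There is a random variable $W\ge0$, defined on the same probability space as $N$, such that $|N'|\overset d=|N|+W$ and such that, if $N'$ is symmetric about zero, then also $N'\overset d=N+\mathrm{sign}(N)\,W$. -/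

import Mathlib

open Set Filter Topology MeasureTheory ProbabilityTheory

noncomputable section

namespace CanonicalNoise

/-- `tradeoff P Q α` is `T(P,Q)(α)`: the smallest type II error `1 - E_Q φ` over all measurable
(randomized) tests `φ` of `P` against `Q` whose type I error `E_P φ` is at most `1 - α`.
It is used for `α ∈ [0,1]` only, where the set below contains `1` and is bounded below by `0`. -/
def tradeoff {Ω : Type*} [MeasurableSpace Ω] (P Q : Measure Ω) (α : ℝ) : ℝ :=
  sInf {β : ℝ | ∃ φ : Ω → ℝ, Measurable φ ∧ (∀ ω, φ ω ∈ Icc (0 : ℝ) 1) ∧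
    ∫ ω, φ ω ∂P ≤ 1 - α ∧ β = 1 - ∫ ω, φ ω ∂Q}

/-- `f` restricted to `[0,1]` is the tradeoff function of some pair of probability measures. -/
def IsTradeoffFunction (f : ℝ → ℝ) : Prop :=
  ∃ (Ω : Type) (_ : MeasurableSpace Ω) (P Q : Measure Ω),
    IsProbabilityMeasure P ∧ IsProbabilityMeasure Q ∧ ∀ α ∈ Icc (0 : ℝ) 1, f α = tradeoff P Q α

/-- Symmetry of a tradeoff function: whenever `f = T(P,Q)`, also `f = T(Q,P)`. -/
def IsSymmetricTradeoff (f : ℝ → ℝ) : Prop :=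
  ∀ (Ω : Type) [MeasurableSpace Ω] (P Q : Measure Ω)
    [IsProbabilityMeasure P] [IsProbabilityMeasure Q],
    (∀ α ∈ Icc (0 : ℝ) 1, f α = tradeoff P Q α) → ∀ α ∈ Icc (0 : ℝ) 1, f α = tradeoff Q P α

/-- `f α < α` for some `α ∈ (0,1)`. -/
def IsNontrivial (f : ℝ → ℝ) : Prop := ∃ α ∈ Ioo (0 : ℝ) 1, f α < α

/-- An infinitely divisible collection `{f t | t ≥ 0}` of symmetric tradeoff functions.
Only the values `f t α` with `t ≥ 0` and `α ∈ [0,1]` matter. -/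
structure IsInfinitelyDivisible (f : ℝ → ℝ → ℝ) : Prop where
  isTradeoff : ∀ t, 0 ≤ t → IsTradeoffFunction (f t)
  isSymmetric : ∀ t, 0 ≤ t → IsSymmetricTradeoff (f t)
  comp : ∀ s t, 0 ≤ s → 0 ≤ t → ∀ α ∈ Icc (0 : ℝ) 1, f s (f t α) = f (s + t) α
  nontrivial : ∀ s, 0 < s → IsNontrivial (f s)
  zero : ∀ α ∈ Icc (0 : ℝ) 1, f 0 α = α
  tendsto_id : ∀ α ∈ Icc (0 : ℝ) 1, Tendsto (fun s => f s α) (𝓝[>] 0) (𝓝 α)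

/-- The law of `X + m` when `X` has law `μ`. -/
def shift (μ : Measure ℝ) (m : ℝ) : Measure ℝ := μ.map (fun x => x + m)

/-- The quantile function `F⁻¹(α) = inf {x | α ≤ F(x)}`, for `α ∈ (0,1)`. -/
def quantile (μ : Measure ℝ) (α : ℝ) : ℝ := sInf {x : ℝ | α ≤ cdf μ x}

/-- The law `μ`, with cdf `F`, is a canonical noise distribution for the tradeoff function `f`. -/
structure IsCND (μ : Measure ℝ) (f : ℝ → ℝ) : Prop where
  continuous_cdf : Continuous (cdf μ)
  private_shift : ∀ m ∈ Icc (0 : ℝ) 1, ∀ α ∈ Icc (0 : ℝ) 1, f α ≤ tradeoff μ (shift μ m) α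
  tight : ∀ α ∈ Ioo (0 : ℝ) 1, f α = tradeoff μ (shift μ 1) α
  threshold : ∀ α ∈ Ioo (0 : ℝ) 1, tradeoff μ (shift μ 1) α = cdf μ (quantile μ α - 1)
  symmetric : ∀ x, cdf μ x = 1 - cdf μ (-x)

/-- `μ` has a log-concave density `exp (C x)`, with `C` concave and allowed to be `-∞` off the
convex set `S`. The normalizing constant is absorbed in `C`. -/
def IsLogConcave (μ : Measure ℝ) : Prop :=
  ∃ (S : Set ℝ) (C : ℝ → ℝ), ConcaveOn ℝ S C ∧
    μ = volume.withDensity (fun x => ENNReal.ofReal (S.indicator (fun y => Real.exp (C y)) x))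

/-- `c_f`, the unique `c ∈ [0,1]` with `f (1 - c) = c`. -/
def crossing (f : ℝ → ℝ) : ℝ := sInf {c : ℝ | c ∈ Icc (0 : ℝ) 1 ∧ f (1 - c) = c}

/-- The linear function `c_f (1/2 - x) + (1 - c_f) (x + 1/2)`. -/
def centralPiece (f : ℝ → ℝ) (x : ℝ) : ℝ :=
  crossing f * (1 / 2 - x) + (1 - crossing f) * (x + 1 / 2)

/-- The constructed CND `F_f` of a symmetric nontrivial tradeoff function: the central piece on
`[-1/2, 1/2]`, continued by `F_f(x) = f (F_f(x+1))` to the left and by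
`F_f(x) = 1 - f (1 - F_f(x-1))` to the right; see the three lemmas below. -/
def constructedCDF (f : ℝ → ℝ) (x : ℝ) : ℝ :=
  if x < -(1 / 2) then f^[⌈-(1 / 2) - x⌉₊] (centralPiece f (x + ⌈-(1 / 2) - x⌉₊))
  else (fun y => 1 - f (1 - y))^[⌈x - 1 / 2⌉₊] (centralPiece f (x - ⌈x - 1 / 2⌉₊))

theorem constructedCDF_of_mem (f : ℝ → ℝ) {x : ℝ} (h₁ : -(1 / 2) ≤ x) (h₂ : x ≤ 1 / 2) :
    constructedCDF f x = centralPiece f x := by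
  have h : ⌈x - 1 / 2⌉₊ = 0 := by
    rw [Nat.ceil_eq_zero]; linarith
  rw [constructedCDF, if_neg (not_lt.mpr h₁), h]
  simp

theorem constructedCDF_of_lt (f : ℝ → ℝ) {x : ℝ} (h : x < -(1 / 2)) :
    constructedCDF f x = f (constructedCDF f (x + 1)) := by
  have hk : ⌈-(1 / 2) - x⌉₊ = ⌈-(1 / 2) - (x + 1)⌉₊ + 1 := by
    by_cases h1 : x + 1 < -(1 / 2)
    · rw [← Nat.ceil_add_one (by linarith)]
      congr 1; ring
    · rw [(Nat.ceil_eq_zero (a := -(1 / 2) - (x + 1))).mpr (by linarith)]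
      rw [Nat.ceil_eq_iff (by norm_num)]
      constructor <;> push_cast <;> linarith
  have hl : constructedCDF f (x + 1) =
      f^[⌈-(1 / 2) - (x + 1)⌉₊] (centralPiece f (x + 1 + ⌈-(1 / 2) - (x + 1)⌉₊)) := by
    by_cases h1 : x + 1 < -(1 / 2)
    · rw [constructedCDF, if_pos h1]
    · rw [constructedCDF_of_mem f (by linarith) (by linarith),
        (Nat.ceil_eq_zero (a := -(1 / 2) - (x + 1))).mpr (by linarith)]
      simp
  rw [hl, constructedCDF, if_pos h, hk, Function.iterate_succ_apply']
  congr 3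
  push_cast; ring

theorem constructedCDF_of_gt (f : ℝ → ℝ) {x : ℝ} (h : 1 / 2 < x) :
    constructedCDF f x = 1 - f (1 - constructedCDF f (x - 1)) := by
  have hk : ⌈x - 1 / 2⌉₊ = ⌈x - 1 - 1 / 2⌉₊ + 1 := by
    by_cases h1 : 1 / 2 < x - 1
    · rw [← Nat.ceil_add_one (by linarith)]
      congr 1; ring
    · rw [(Nat.ceil_eq_zero (a := x - 1 - 1 / 2)).mpr (by linarith)]
      rw [Nat.ceil_eq_iff (by norm_num)]
      constructor <;> push_cast <;> linarith
  rw [constructedCDF, if_neg (by linarith), hk, Function.iterate_succ_apply',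
    constructedCDF, if_neg (by linarith)]
  have e : x - ((⌈x - 1 - 1 / 2⌉₊ + 1 : ℕ) : ℝ) = x - 1 - (⌈x - 1 - 1 / 2⌉₊ : ℝ) := by
    push_cast; ring
  rw [e]

/-- `μ` is the log-concave CND of the infinitely divisible collection `f`: the log-concave CND for
`f 1` which is the limit, as `s ↓ 0`, of the constructed CNDs for `f s` rescaled by `s`. The limit
selects the distribution that belongs to the whole collection: being a log-concave CND for the
single function `f 1` does not always determine `μ`. -/
structure IsLogConcaveCND (μ : Measure ℝ) (f : ℝ → ℝ → ℝ) : Prop where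
  isLogConcave : IsLogConcave μ
  isCND : IsCND μ (f 1)
  isLimit : ∀ x, Tendsto (fun s => constructedCDF (f s) (x / s)) (𝓝[>] 0) (𝓝 (cdf μ x))

/-- First order stochastic dominance of laws on `ℝ`: `μ` stochastically dominates `ν`. -/
def StochasticallyDominates (μ ν : Measure ℝ) : Prop := ∀ t, cdf μ t ≤ cdf ν t

/-- The expectation `E X = E X⁺ - E X⁻` in `[-∞, ∞]`, meaningful when one of `X⁺`, `X⁻` is
integrable (in particular when `X` is bounded below). -/
def extExpectation {Ω : Type*} [MeasurableSpace Ω] (P : Measure Ω) (X : Ω → ℝ) : EReal :=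
  ((∫⁻ ω, ENNReal.ofReal (X ω) ∂P : ENNReal) : EReal) -
    ((∫⁻ ω, ENNReal.ofReal (-X ω) ∂P : ENNReal) : EReal)

end CanonicalNoise

end

/-! Everything reduces to a bound on intervals: `P'(|N' - a| ≤ t) ≤ 2 F(t) - 1`, whose right side is
`P(|N| ≤ t)` because `F` is symmetric and continuous.

For `s > t`, an interval of half-width `t` has mass at most `u - P'(N' + 2s ≤ a + t)`, where `u =
P'(N' ≤ a + t)`. Privacy for the shift `2s`, tested on a half-line, bounds this by `u - f_{2s}(u)`.
The graph of a symmetric tradeoff function is convex and, up to boundary effects, invariant under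
`(x, y) ↦ (1 - y, 1 - x)`, so `u - f(u)` is largest where the graph meets the axis `x + y = 1`.
Heuristically that point for `f_{2s}` is `(F(s), F(-s))`. It is enough that `1 - d ≤ f_{2s}(d)` for
approximations `d` of `F(s)`. The constructed CND of `f_r` with `r = 2s/(2j+1)` supplies them, since
its argument `s/r = j + 1/2` is a breakpoint and `f_{2s}` is the `(2j+1)`-fold iterate of `f_r`.
Letting `j → ∞` and then `s ↓ t` finishes the bound (`SymmetricProfile.sub_le`,
`IsInfinitelyDivisible.sub_le_of_isLimit`, `measureReal_abs_sub_le`).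

The remaining claims follow from the quantile coupling of `|N|` with `|N' - a|`
(`exists_monotone_coupling`). A symmetric law is determined by the law of its absolute value, which
gives the signed version. -/

noncomputable section

namespace CanonicalNoise

/-! ### Randomized tests and the order properties of tradeoff functions -/

section Tests

variable {Ω : Type*} [MeasurableSpace Ω] {P Q : Measure Ω}

theorem integrable_test (P : Measure Ω) [IsProbabilityMeasure P] {φ : Ω → ℝ} (hφ : Measurable φ)
    (h : ∀ ω, φ ω ∈ Icc (0 : ℝ) 1) : Integrable φ P :=
  Integrable.of_mem_Icc 0 1 hφ.aemeasurable (ae_of_all _ h)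

theorem integral_test_le_one (P : Measure Ω) [IsProbabilityMeasure P] {φ : Ω → ℝ}
    (hφ : Measurable φ) (h : ∀ ω, φ ω ∈ Icc (0 : ℝ) 1) : ∫ ω, φ ω ∂P ≤ 1 := by
  have := integral_mono (integrable_test P hφ h) (integrable_const (1 : ℝ)) (fun ω => (h ω).2)
  simpa using this

theorem integral_one_sub (P : Measure Ω) [IsProbabilityMeasure P] {φ : Ω → ℝ}
    (hφ : Measurable φ) (h : ∀ ω, φ ω ∈ Icc (0 : ℝ) 1) :
    ∫ ω, (1 - φ ω) ∂P = 1 - ∫ ω, φ ω ∂P := by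
  rw [integral_sub (integrable_const _) (integrable_test P hφ h)]
  simp

theorem tradeoff_le [IsProbabilityMeasure Q] {φ : Ω → ℝ} {α : ℝ} (hφ : Measurable φ) (h : ∀ ω, φ ω ∈ Icc (0 : ℝ) 1)
    (hα : ∫ ω, φ ω ∂P ≤ 1 - α) : tradeoff P Q α ≤ 1 - ∫ ω, φ ω ∂Q := by
  refine csInf_le ⟨0, ?_⟩ ⟨φ, hφ, h, hα, rfl⟩
  rintro _ ⟨ψ, hψ, h', -, rfl⟩
  linarith [integral_test_le_one Q hψ h']

theorem tradeoff_set_nonempty {α : ℝ} (hα : α ≤ 1) :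
    {β : ℝ | ∃ φ : Ω → ℝ, Measurable φ ∧ (∀ ω, φ ω ∈ Icc (0 : ℝ) 1) ∧
      ∫ ω, φ ω ∂P ≤ 1 - α ∧ β = 1 - ∫ ω, φ ω ∂Q}.Nonempty :=
  ⟨_, fun _ => 0, measurable_const, fun _ => by simp, by simpa using hα, rfl⟩

theorem le_tradeoff {α b : ℝ} (hα : α ≤ 1)
    (h : ∀ φ : Ω → ℝ, Measurable φ → (∀ ω, φ ω ∈ Icc (0 : ℝ) 1) →
      ∫ ω, φ ω ∂P ≤ 1 - α → b ≤ 1 - ∫ ω, φ ω ∂Q) : b ≤ tradeoff P Q α := by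
  refine le_csInf (tradeoff_set_nonempty hα) ?_
  rintro _ ⟨ψ, hψ, h', h'', rfl⟩
  exact h ψ hψ h' h''

theorem exists_test_lt {α b : ℝ} (hα : α ≤ 1) (hb : tradeoff P Q α < b) :
    ∃ φ : Ω → ℝ, Measurable φ ∧ (∀ ω, φ ω ∈ Icc (0 : ℝ) 1) ∧
      ∫ ω, φ ω ∂P ≤ 1 - α ∧ 1 - ∫ ω, φ ω ∂Q < b := by
  obtain ⟨_, ⟨φ, h1, h2, h3, rfl⟩, h4⟩ := exists_lt_of_csInf_lt (tradeoff_set_nonempty hα) hb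
  exact ⟨φ, h1, h2, h3, h4⟩

theorem tradeoff_nonneg [IsProbabilityMeasure Q] {α : ℝ} (hα : α ≤ 1) : 0 ≤ tradeoff P Q α :=
  le_tradeoff hα fun _ hφ h _ => sub_nonneg.2 (integral_test_le_one Q hφ h)

theorem tradeoff_le_self [IsProbabilityMeasure P] [IsProbabilityMeasure Q] {α : ℝ} (hα : α ∈ Icc (0 : ℝ) 1) : tradeoff P Q α ≤ α := by
  have := tradeoff_le (P := P) (Q := Q) (φ := fun _ => 1 - α) (α := α) measurable_const
    (fun _ => ⟨by linarith [hα.2], by linarith [hα.1]⟩) (by simp)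
  simpa using this

theorem tradeoff_mono [IsProbabilityMeasure Q] {α β : ℝ} (hαβ : α ≤ β) (hβ : β ≤ 1) :
    tradeoff P Q α ≤ tradeoff P Q β :=
  le_tradeoff hβ fun _ hφ h h' => tradeoff_le hφ h (by linarith)

variable [IsProbabilityMeasure P] [IsProbabilityMeasure Q]

theorem convexOn_tradeoff : ConvexOn ℝ (Icc (0 : ℝ) 1) (tradeoff P Q) := by
  refine ⟨convex_Icc 0 1, fun x hx y hy a b ha hb hab => ?_⟩
  refine le_of_forall_pos_le_add fun ε hε => ?_
  obtain ⟨φ, h1, h2, h3, h4⟩ := exists_test_lt (P := P) (Q := Q) hx.2 (lt_add_of_pos_right _ hε)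
  obtain ⟨ψ, k1, k2, k3, k4⟩ := exists_test_lt (P := P) (Q := Q) hy.2 (lt_add_of_pos_right _ hε)
  have hlin (ν : Measure Ω) [IsProbabilityMeasure ν] :
      ∫ ω, (a * φ ω + b * ψ ω) ∂ν = a * (∫ ω, φ ω ∂ν) + b * (∫ ω, ψ ω ∂ν) := by
    rw [integral_add ((integrable_test ν h1 h2).const_mul a)
      ((integrable_test ν k1 k2).const_mul b), integral_const_mul, integral_const_mul]
  have hle := tradeoff_le (P := P) (Q := Q) (φ := fun ω => a * φ ω + b * ψ ω)
    (α := a * x + b * y) (by fun_prop) (fun ω => by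
      simpa using (convex_Icc (0 : ℝ) 1) (h2 ω) (k2 ω) ha hb hab) (by
      rw [hlin P]
      nlinarith [mul_le_mul_of_nonneg_left h3 ha, mul_le_mul_of_nonneg_left k3 hb])
  rw [hlin Q] at hle
  simp only [smul_eq_mul]
  nlinarith [mul_le_mul_of_nonneg_left h4.le ha, mul_le_mul_of_nonneg_left k4.le hb]

/-- Replacing a test `φ` by `1 - φ` exchanges the two error types. The slack `b` stands in for an
optimal test, whose existence is never needed. -/
theorem tradeoff_swap_le {u b : ℝ} (hu : u ≤ 1) (hb : tradeoff P Q u < b) :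
    tradeoff Q P (1 - b) ≤ 1 - u := by
  obtain ⟨φ, h1, h2, h3, h4⟩ := exists_test_lt hu hb
  have := tradeoff_le (P := Q) (Q := P) (φ := fun ω => 1 - φ ω) (α := 1 - b)
    (by fun_prop) (fun ω => ⟨by linarith [(h2 ω).2], by linarith [(h2 ω).1]⟩)
    (by rw [integral_one_sub Q h1 h2]; linarith)
  rw [integral_one_sub P h1 h2] at this
  linarith

/-- A violating test, complemented, would give some `y > x` with `T(y) ≤ T(x)`. Convexity and `T(0)
= 0` force `T(x) ≤ (x/y) T(y)`, which is impossible when `T(x) > 0`. Positivity excludes an initial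
interval on which `T` vanishes. -/
theorem le_tradeoff_swap {x : ℝ} (hx : x ∈ Icc (0 : ℝ) 1) (hpos : 0 < tradeoff P Q x) :
    1 - x ≤ tradeoff Q P (1 - tradeoff P Q x) := by
  refine le_tradeoff (by linarith) fun φ h1 h2 h3 => ?_
  by_contra! hlt
  set y := ∫ ω, φ ω ∂P with hy
  have hy1 : y ≤ 1 := integral_test_le_one P h1 h2
  have hxy : x < y := by linarith
  have hy0 : 0 < y := hx.1.trans_lt hxy
  have hle := tradeoff_le (P := P) (Q := Q) (φ := fun ω => 1 - φ ω) (α := y)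
    (by fun_prop) (fun ω => ⟨by linarith [(h2 ω).2], by linarith [(h2 ω).1]⟩)
    (by rw [integral_one_sub P h1 h2])
  rw [integral_one_sub Q h1 h2] at hle
  have h0 : tradeoff P Q 0 ≤ 0 := tradeoff_le_self ⟨le_rfl, zero_le_one⟩
  have hconv := (convexOn_tradeoff (P := P) (Q := Q)).2 (show (0 : ℝ) ∈ Icc 0 1 by simp)
    ⟨hy0.le, hy1⟩ (show 0 ≤ 1 - x / y by rw [sub_nonneg, div_le_one hy0]; exact hxy.le)
    (div_nonneg hx.1 hy0.le) (by ring)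
  have hxy' : x / y < 1 := (div_lt_one hy0).2 hxy
  have e : (1 - x / y) • (0 : ℝ) + (x / y) • y = x := by
    simp only [smul_eq_mul]; field_simp; ring
  rw [e] at hconv
  simp only [smul_eq_mul] at hconv
  nlinarith [div_nonneg hx.1 hy0.le, mul_nonneg (div_nonneg hx.1 hy0.le) hpos.le]

end Tests

/-! ### Convexity and reflection symmetry of a single tradeoff function -/

/-- The properties of symmetric tradeoff functions on `[0,1]` that do not mention tests. -/
structure SymmetricProfile (f : ℝ → ℝ) : Prop where
  nonneg : ∀ x ∈ Icc (0 : ℝ) 1, 0 ≤ f x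
  le_self : ∀ x ∈ Icc (0 : ℝ) 1, f x ≤ x
  monotoneOn : MonotoneOn f (Icc 0 1)
  convexOn : ConvexOn ℝ (Icc 0 1) f
  reflect_le : ∀ x ∈ Icc (0 : ℝ) 1, ∀ b, f x < b → b ≤ 1 → f (1 - b) ≤ 1 - x
  le_reflect : ∀ x ∈ Icc (0 : ℝ) 1, 0 < f x → 1 - x ≤ f (1 - f x)

theorem IsTradeoffFunction.symmetricProfile {f : ℝ → ℝ} (hf : IsTradeoffFunction f)
    (hs : IsSymmetricTradeoff f) : SymmetricProfile f := by
  obtain ⟨Ω, _, P, Q, _, _, h⟩ := hf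
  have h' := hs Ω P Q h
  have hn : ∀ x ∈ Icc (0 : ℝ) 1, 0 ≤ f x := fun x hx => h x hx ▸ tradeoff_nonneg hx.2
  have hl : ∀ x ∈ Icc (0 : ℝ) 1, f x ≤ x := fun x hx => h x hx ▸ tradeoff_le_self hx
  refine ⟨hn, hl, ?_, convexOn_tradeoff.congr fun x hx => (h x hx).symm, ?_, ?_⟩
  · intro x hx y hy hxy
    rw [h x hx, h y hy]
    exact tradeoff_mono hxy hy.2
  · intro x hx b hb hb1
    rw [h' _ ⟨by linarith, by linarith [hn x hx]⟩]
    rw [h x hx] at hb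
    exact tradeoff_swap_le hx.2 hb
  · intro x hx hpos
    rw [h' _ ⟨by linarith [hl x hx, hx.2], by linarith⟩, h x hx]
    rw [h x hx] at hpos
    exact le_tradeoff_swap hx hpos

namespace SymmetricProfile

variable {f : ℝ → ℝ}

theorem mapsTo (hf : SymmetricProfile f) : MapsTo f (Icc 0 1) (Icc 0 1) :=
  fun x hx => ⟨hf.nonneg x hx, (hf.le_self x hx).trans hx.2⟩

theorem map_zero (hf : SymmetricProfile f) : f 0 = 0 :=
  le_antisymm (hf.le_self 0 (by simp)) (hf.nonneg 0 (by simp))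

/-- The midpoint `m` of `u` and its mirror abscissa `1 - f u` satisfies `f m ≤ 1 - m` by convexity.
If `m > d`, monotonicity would give `f m ≥ f d ≥ 1 - d > 1 - m`. Hence `u - f u = 2m - 1 ≤ 2d - 1`,
up to the `ε` required by `reflect_le`. -/
theorem sub_le (hf : SymmetricProfile f) {d u : ℝ} (hd : d ∈ Icc (0 : ℝ) 1)
    (hfd : 1 - d ≤ f d) (hu : u ∈ Icc (0 : ℝ) 1) : u - f u ≤ 2 * d - 1 := by
  by_contra! hlt
  have hdd := hf.le_self d hd
  have hu0 := hf.nonneg u hu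
  obtain ⟨ε, hε, hε'⟩ : ∃ ε > 0, 2 * d - 1 < u - f u - ε :=
    ⟨(u - f u - (2 * d - 1)) / 2, by linarith, by linarith⟩
  have hb : f u + ε ≤ 1 := by linarith [hu.2]
  have hr := hf.reflect_le u hu (f u + ε) (by linarith) hb
  have hv : 1 - (f u + ε) ∈ Icc (0 : ℝ) 1 := ⟨by linarith, by linarith⟩
  have hc := hf.convexOn.2 hu hv (one_half_pos (α := ℝ)).le one_half_pos.le (by norm_num)
  have hm := hf.convexOn.1 hu hv (one_half_pos (α := ℝ)).le one_half_pos.le (by norm_num)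
  have hmono := hf.monotoneOn hd hm (by simp only [smul_eq_mul]; linarith)
  simp only [smul_eq_mul] at hc hmono
  linarith

/-- The lower bound at `1/2` makes `f (1 - c) - c` change sign on `[1/4, 3/4]`, away from the
endpoint `1`, where a convex function may jump. -/
theorem crossing_spec (hf : SymmetricProfile f) (h : 1 / 4 < f (1 / 2)) :
    crossing f ∈ Icc (0 : ℝ) 1 ∧ f (1 - crossing f) = crossing f := by
  have hcont : ContinuousOn (fun c => f (1 - c) - c) (Icc (1 / 4) (3 / 4)) := by
    have h1 : ContinuousOn f (Ioo 0 1) := by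
      have := hf.convexOn.continuousOn_interior
      rwa [interior_Icc] at this
    refine ContinuousOn.sub (h1.comp (by fun_prop) ?_) continuousOn_id
    intro c hc
    exact ⟨by linarith [hc.2], by linarith [hc.1]⟩
  have hm : f (1 / 2) ≤ f (3 / 4) := hf.monotoneOn (by constructor <;> norm_num)
    (by constructor <;> norm_num) (by norm_num)
  have hl := hf.le_self (1 / 4) (by constructor <;> norm_num)
  obtain ⟨c, hc, hc'⟩ := intermediate_value_Icc' (by norm_num) hcont
    (show (0 : ℝ) ∈ _ by norm_num; constructor <;> linarith)
  have hc' : f (1 - c) = c := by simpa [sub_eq_zero] using hc'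
  have hc1 : c ∈ Icc (0 : ℝ) 1 := ⟨by linarith [hc.1], by linarith [hc.2]⟩
  have hset : {c : ℝ | c ∈ Icc (0 : ℝ) 1 ∧ f (1 - c) = c} = {c} := by
    ext b
    refine ⟨fun ⟨hb, hb'⟩ => ?_, fun hb => by rw [mem_singleton_iff.1 hb]; exact ⟨hc1, hc'⟩⟩
    have mono {x y : ℝ} (hx : x ∈ Icc (0 : ℝ) 1) (hy : y ∈ Icc (0 : ℝ) 1) (hxy : x ≤ y) :
        f (1 - y) ≤ f (1 - x) :=
      hf.monotoneOn ⟨by linarith [hy.2], by linarith [hy.1]⟩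
        ⟨by linarith [hx.2], by linarith [hx.1]⟩ (by linarith)
    rw [mem_singleton_iff]
    rcases le_total b c with hbc | hbc
    · linarith [mono hb hc1 hbc]
    · linarith [mono hc1 hb hbc]
  rw [crossing, hset, csInf_singleton]
  exact ⟨hc1, hc'⟩

theorem iterate_mapsTo (hf : SymmetricProfile f) (n : ℕ) :
    MapsTo f^[n] (Icc 0 1) (Icc 0 1) := hf.mapsTo.iterate n

theorem iterate_mono (hf : SymmetricProfile f) (n : ℕ) : MonotoneOn f^[n] (Icc 0 1) := by
  induction n with
  | zero => exact fun _ _ _ _ h => h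
  | succ n ih =>
    intro x hx y hy hxy
    exact ih (hf.mapsTo hx) (hf.mapsTo hy) (hf.monotoneOn hx hy hxy)

/-- Reflection turns each step down the orbit of `c` into a step back: `f` sends the mirror image of
`f^[j+1] c` to at least that of `f^[j] c`. Positivity passes to earlier iterates because `f 0 = 0`.
-/
theorem one_sub_le_iterate (hf : SymmetricProfile f) {c : ℝ} (hc : c ∈ Icc (0 : ℝ) 1) (j : ℕ)
    (hpos : 0 < f^[j] c) : 1 - c ≤ f^[j] (1 - f^[j] c) := by
  induction j with
  | zero => simp
  | succ j ih =>
    have hy := hf.iterate_mapsTo j hc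
    have hpos' : 0 < f^[j] c := by
      refine hy.1.lt_of_ne fun h0 => ?_
      rw [Function.iterate_succ_apply', ← h0, hf.map_zero] at hpos
      exact lt_irrefl _ hpos
    rw [Function.iterate_succ_apply'] at hpos
    rw [Function.iterate_succ_apply, Function.iterate_succ_apply']
    have hfy := hf.mapsTo hy
    have hI : ∀ z ∈ Icc (0 : ℝ) 1, 1 - z ∈ Icc (0 : ℝ) 1 :=
      fun z hz => ⟨by linarith [hz.2], by linarith [hz.1]⟩
    exact (ih hpos').trans (hf.iterate_mono j (hI _ hy) (hf.mapsTo (hI _ hfy))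
      (hf.le_reflect _ hy hpos))

/-- With `d = 1 - f^[j] c` this is the hypothesis `1 - d ≤ g d` of `sub_le` for `g = f^[2j+1]`: `j`
steps climb from `d` to at least `1 - c`, one crosses to `c`, and `j` more descend to `f^[j] c`. -/
theorem iterate_le_iterate_two_mul (hf : SymmetricProfile f) {c : ℝ} (hc : c ∈ Icc (0 : ℝ) 1)
    (hfc : f (1 - c) = c) (j : ℕ) : f^[j] c ≤ f^[2 * j + 1] (1 - f^[j] c) := by
  have hj := hf.iterate_mapsTo j hc
  have hj' : 1 - f^[j] c ∈ Icc (0 : ℝ) 1 := ⟨by linarith [hj.2], by linarith [hj.1]⟩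
  rcases hj.1.eq_or_lt with h0 | hpos
  · rw [← h0] at hj' ⊢
    exact (hf.iterate_mapsTo _ hj').1
  · have h := hf.iterate_mono (j + 1) (show 1 - c ∈ Icc (0 : ℝ) 1 from
      ⟨by linarith [hc.2], by linarith [hc.1]⟩)
      (hf.iterate_mapsTo j hj') (hf.one_sub_le_iterate hc j hpos)
    rwa [Function.iterate_succ_apply, hfc, ← Function.iterate_add_apply,
      show j + 1 + j = 2 * j + 1 by ring] at h

end SymmetricProfile

/-! ### From the constructed CNDs to a bound on `u - f_{2t}(u)` -/

theorem constructedCDF_nat_add_half (f : ℝ → ℝ) (j : ℕ) :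
    constructedCDF f (j + 1 / 2) = 1 - f^[j] (crossing f) := by
  have hj : (0 : ℝ) ≤ j := j.cast_nonneg
  rw [constructedCDF, if_neg (by linarith), show (j : ℝ) + 1 / 2 - 1 / 2 = j by ring,
    Nat.ceil_natCast, show (j : ℝ) + 1 / 2 - j = 1 / 2 by ring,
    show centralPiece f (1 / 2) = 1 - crossing f by rw [centralPiece]; ring]
  induction j with
  | zero => simp
  | succ j ih =>
    rw [Function.iterate_succ_apply', Function.iterate_succ_apply', ih j.cast_nonneg]
    simp

namespace IsInfinitelyDivisible

variable {f : ℝ → ℝ → ℝ}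

theorem symmetricProfile (hf : IsInfinitelyDivisible f) {t : ℝ} (ht : 0 ≤ t) :
    SymmetricProfile (f t) :=
  (hf.isTradeoff t ht).symmetricProfile (hf.isSymmetric t ht)

theorem iterate_eq (hf : IsInfinitelyDivisible f) {s : ℝ} (hs : 0 ≤ s) (n : ℕ) {x : ℝ}
    (hx : x ∈ Icc (0 : ℝ) 1) : (f s)^[n] x = f (n * s) x := by
  induction n with
  | zero => simpa using (hf.zero x hx).symm
  | succ n ih =>
    rw [Function.iterate_succ_apply', ih, hf.comp s (n * s) hs (by positivity) x hx]
    congr 1; push_cast; ring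

theorem sub_le_of_isLimit (hf : IsInfinitelyDivisible f) {F : ℝ → ℝ}
    (hF : ∀ x, Tendsto (fun s => constructedCDF (f s) (x / s)) (𝓝[>] 0) (𝓝 (F x)))
    {t u : ℝ} (ht : 0 < t) (hu : u ∈ Icc (0 : ℝ) 1) : u - f (2 * t) u ≤ 2 * F t - 1 := by
  -- These scales put `t/s` at the half-integer `j + 1/2` and make `2t` exactly `2j + 1` steps of
  -- size `s`.
  have hs : ∀ j : ℕ, 0 < 2 * t / (2 * j + 1) := fun j => by positivity
  have hlim : Tendsto (fun j : ℕ => 2 * t / (2 * (j : ℝ) + 1)) atTop (𝓝[>] 0) := by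
    refine tendsto_nhdsWithin_iff.2 ⟨?_, Eventually.of_forall hs⟩
    refine tendsto_const_nhds.div_atTop ?_
    exact tendsto_atTop_add_const_right _ _
      (tendsto_natCast_atTop_atTop.const_mul_atTop two_pos)
  have h := (((hF t).comp hlim).const_mul 2).sub_const 1
  refine ge_of_tendsto h ?_
  have hhalf := (hf.tendsto_id (1 / 2) (by constructor <;> norm_num)).comp hlim
  filter_upwards [hhalf.eventually (lt_mem_nhds (show (1 / 4 : ℝ) < 1 / 2 by norm_num))]
    with j hj
  have hp := hf.symmetricProfile (hs j).le
  obtain ⟨hc, hfc⟩ := hp.crossing_spec hj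
  have key := hp.iterate_le_iterate_two_mul hc hfc j
  have hmem := hp.iterate_mapsTo j hc
  have hd : 1 - (f (2 * t / (2 * j + 1)))^[j] (crossing (f (2 * t / (2 * j + 1)))) ∈
      Icc (0 : ℝ) 1 := ⟨by linarith [hmem.2], by linarith [hmem.1]⟩
  rw [hf.iterate_eq (hs j).le _ hd, show ((2 * j + 1 : ℕ) : ℝ) * (2 * t / (2 * j + 1)) = 2 * t by
    push_cast; field_simp] at key
  have e : t / (2 * t / (2 * (j : ℝ) + 1)) = j + 1 / 2 := by field_simp
  simp only [Function.comp_apply, e, constructedCDF_nat_add_half]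
  exact (hf.symmetricProfile (by positivity)).sub_le hd (by linarith) hu

end IsInfinitelyDivisible

/-! ### Quantile coupling of stochastically ordered laws -/

section Quantile

theorem quantile_le_iff (μ : Measure ℝ) {u x : ℝ} (hu : u ∈ Ioo (0 : ℝ) 1) :
    quantile μ u ≤ x ↔ u ≤ cdf μ x := by
  obtain ⟨b, hb⟩ := ((tendsto_cdf_atBot μ).eventually (gt_mem_nhds hu.1)).exists
  obtain ⟨c, hc⟩ := ((tendsto_cdf_atTop μ).eventually (lt_mem_nhds hu.2)).exists
  have hbdd : BddBelow {x | u ≤ cdf μ x} := by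
    refine ⟨b, fun y hy => ?_⟩
    by_contra! h
    exact absurd (lt_of_le_of_lt (le_trans hy (monotone_cdf μ h.le)) hb) (lt_irrefl _)
  refine ⟨fun h => ?_, fun h => csInf_le hbdd h⟩
  refine le_trans ?_ (monotone_cdf μ h)
  refine ge_of_tendsto (((cdf μ).right_continuous (quantile μ u)).mono_left
    (nhdsWithin_mono _ Ioi_subset_Ici_self)) ?_
  filter_upwards [self_mem_nhdsWithin] with y hy
  obtain ⟨s, hs, hsy⟩ := exists_lt_of_csInf_lt ⟨c, hc.le⟩ (mem_Ioi.1 hy)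
  exact le_trans hs (monotone_cdf μ hsy.le)

/-- The quantile function, set to `0` outside `(0,1)`. -/
def unitQuantile (μ : Measure ℝ) (u : ℝ) : ℝ := (Ioo (0 : ℝ) 1).indicator (quantile μ) u

theorem measurable_unitQuantile (μ : Measure ℝ) : Measurable (unitQuantile μ) := by
  refine measurable_of_Iic fun x => ?_
  have : unitQuantile μ ⁻¹' Iic x =
      (Ioo 0 1 ∩ Iic (cdf μ x)) ∪ ((Ioo 0 1)ᶜ ∩ {_u | (0 : ℝ) ≤ x}) := by
    ext u
    by_cases hu : u ∈ Ioo (0 : ℝ) 1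
    · have h := quantile_le_iff μ (x := x) hu
      simp only [unitQuantile, mem_preimage, indicator_of_mem hu, mem_Iic, mem_union, mem_inter_iff,
        mem_compl_iff, hu, h]
      simp
    · simp only [unitQuantile, mem_preimage, indicator_of_notMem hu, mem_Iic, mem_union,
        mem_inter_iff, mem_compl_iff, hu]
      simp
  rw [this]
  exact (measurableSet_Ioo.inter measurableSet_Iic).union
    (measurableSet_Ioo.compl.inter (MeasurableSet.const _))

variable {Ω : Type*} [MeasurableSpace Ω] {P : Measure Ω} [IsProbabilityMeasure P] {Z : Ω → ℝ}

theorem cdf_map_eq (hZ : Measurable Z) (x : ℝ) : cdf (P.map Z) x = P.real {ω | Z ω ≤ x} := by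
  have := Measure.isProbabilityMeasure_map (μ := P) hZ.aemeasurable
  rw [cdf_eq_real, map_measureReal_apply hZ measurableSet_Iic]
  rfl

theorem exists_cdf_eq {μ : Measure ℝ} (hc : Continuous (cdf μ)) {v : ℝ}
    (hv : v ∈ Ioo (0 : ℝ) 1) : ∃ x, cdf μ x = v := by
  obtain ⟨b, hb⟩ := ((tendsto_cdf_atBot μ).eventually (gt_mem_nhds hv.1)).exists
  obtain ⟨c, hc'⟩ := ((tendsto_cdf_atTop μ).eventually (lt_mem_nhds hv.2)).exists
  exact mem_range_of_exists_le_of_exists_ge hc ⟨b, hb.le⟩ ⟨c, hc'.le⟩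

/-- The probability integral transform. The upper bound goes through levels `w > v`, because `v` may
be attained on a whole flat stretch of the cdf. -/
theorem measureReal_cdf_le (hZ : Measurable Z) (hc : Continuous (cdf (P.map Z))) {v : ℝ}
    (hv : v ∈ Ioo (0 : ℝ) 1) : P.real {ω | cdf (P.map Z) (Z ω) ≤ v} = v := by
  apply le_antisymm
  · refine le_of_forall_gt_imp_ge_of_dense fun w hw => ?_
    rcases le_or_gt 1 w with h1 | h1
    · exact measureReal_le_one.trans h1
    obtain ⟨y, hy⟩ := exists_cdf_eq hc (v := w) ⟨hv.1.trans hw, h1⟩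
    rw [← hy, cdf_map_eq hZ]
    refine measureReal_mono fun ω hω => ?_
    have hω : cdf (P.map Z) (Z ω) ≤ v := hω
    by_contra hlt
    have := monotone_cdf (P.map Z) (not_le.1 hlt).le
    linarith
  · obtain ⟨x, hx⟩ := exists_cdf_eq hc hv
    conv_lhs => rw [← hx, cdf_map_eq hZ]
    refine measureReal_mono fun ω hω => ?_
    have := monotone_cdf (P.map Z) (show Z ω ≤ x from hω)
    exact this.trans hx.le

theorem ae_cdf_mem_Ioo (hZ : Measurable Z) (hc : Continuous (cdf (P.map Z))) :
    ∀ᵐ ω ∂P, cdf (P.map Z) (Z ω) ∈ Ioo (0 : ℝ) 1 := by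
  have hm : Measurable fun ω => cdf (P.map Z) (Z ω) := hc.measurable.comp hZ
  have h0 : P.real {ω | cdf (P.map Z) (Z ω) ≤ 0} = 0 := by
    refine le_antisymm (le_of_forall_gt_imp_ge_of_dense fun v hv => ?_) measureReal_nonneg
    rcases le_or_gt 1 v with h1 | h1
    · exact measureReal_le_one.trans h1
    · refine le_trans (measureReal_mono fun ω hω => ?_) (measureReal_cdf_le hZ hc ⟨hv, h1⟩).le
      exact le_trans (show cdf (P.map Z) (Z ω) ≤ 0 from hω) hv.le
  have h1 : P.real {ω | 1 ≤ cdf (P.map Z) (Z ω)} = 0 := by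
    refine le_antisymm (le_of_forall_gt_imp_ge_of_dense fun v hv => ?_) measureReal_nonneg
    rcases le_or_gt 1 v with h1 | h1
    · exact measureReal_le_one.trans h1
    · have hle := measureReal_cdf_le hZ hc (v := 1 - v) ⟨by linarith, by linarith⟩
      have hcompl := probReal_compl_eq_one_sub (μ := P)
        (s := {ω | cdf (P.map Z) (Z ω) ≤ 1 - v}) (measurableSet_le hm measurable_const)
      have : P.real {ω | 1 ≤ cdf (P.map Z) (Z ω)} ≤
          P.real {ω | cdf (P.map Z) (Z ω) ≤ 1 - v}ᶜ := by
        refine measureReal_mono fun ω hω => ?_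
        have hω : 1 ≤ cdf (P.map Z) (Z ω) := hω
        exact fun h => absurd (hω.trans h) (by linarith)
      linarith
  rw [measureReal_eq_zero_iff] at h0 h1
  filter_upwards [measure_eq_zero_iff_ae_notMem.1 h0, measure_eq_zero_iff_ae_notMem.1 h1]
    with ω k0 k1
  exact ⟨not_le.1 k0, not_le.1 k1⟩

variable {Ω' : Type*} [MeasurableSpace Ω'] {P' : Measure Ω'} [IsProbabilityMeasure P']
  {Y : Ω' → ℝ}

theorem identDistrib_unitQuantile_cdf (hZ : Measurable Z) (hc : Continuous (cdf (P.map Z)))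
    (hY : Measurable Y) :
    IdentDistrib Y (fun ω => unitQuantile (P'.map Y) (cdf (P.map Z) (Z ω))) P' P := by
  have hm : Measurable fun ω => unitQuantile (P'.map Y) (cdf (P.map Z) (Z ω)) :=
    (measurable_unitQuantile _).comp (hc.measurable.comp hZ)
  refine ⟨hY.aemeasurable, hm.aemeasurable, ?_⟩
  have := Measure.isProbabilityMeasure_map (μ := P') hY.aemeasurable
  have := Measure.isProbabilityMeasure_map (μ := P) hm.aemeasurable
  refine Measure.eq_of_cdf _ _ (StieltjesFunction.ext fun x => ?_)
  rw [cdf_map_eq hm]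
  have hae : {ω | unitQuantile (P'.map Y) (cdf (P.map Z) (Z ω)) ≤ x} =ᵐ[P]
      {ω | cdf (P.map Z) (Z ω) ≤ cdf (P'.map Y) x} := by
    refine eventuallyEq_set.2 ?_
    filter_upwards [ae_cdf_mem_Ioo hZ hc] with ω hω
    have h := quantile_le_iff (P'.map Y) (x := x) hω
    change unitQuantile _ _ ≤ x ↔ _ ≤ _
    rwa [unitQuantile, indicator_of_mem hω]
  rw [measureReal_congr hae]
  rcases (cdf_nonneg (P'.map Y) x).eq_or_lt with h0 | h0
  · rw [← h0, eq_comm, measureReal_eq_zero_iff, measure_eq_zero_iff_ae_notMem]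
    filter_upwards [ae_cdf_mem_Ioo hZ hc] with ω hω
    exact not_le.2 hω.1
  rcases (cdf_le_one (P'.map Y) x).eq_or_lt with h1 | h1
  · rw [h1]
    have : {ω | cdf (P.map Z) (Z ω) ≤ 1} = univ := eq_univ_of_forall fun ω => cdf_le_one _ _
    rw [this, probReal_univ]
  · exact (measureReal_cdf_le hZ hc ⟨h0, h1⟩).symm

/-- Failure would place a rational `q` below `Z` with `F(Z) ≤ F(q)`, so `Z` would lie on a flat
stretch of its own cdf. Each such event is null, and there are countably many `q`. -/
theorem ae_le_unitQuantile_cdf {P' : Measure Ω'} (hZ : Measurable Z) (hc : Continuous (cdf (P.map Z)))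
    (hle : ∀ t, cdf (P'.map Y) t ≤ cdf (P.map Z) t) :
    ∀ᵐ ω ∂P, Z ω ≤ unitQuantile (P'.map Y) (cdf (P.map Z) (Z ω)) := by
  have hflat (q : ℚ) : ∀ᵐ ω ∂P, cdf (P.map Z) (Z ω) ∈ Ioo (0 : ℝ) 1 →
      cdf (P.map Z) (Z ω) ≤ cdf (P.map Z) q → Z ω ≤ q := by
    by_cases hq : cdf (P.map Z) q ∈ Ioo (0 : ℝ) 1
    · have hsub : {ω | Z ω ≤ q} ⊆ {ω | cdf (P.map Z) (Z ω) ≤ cdf (P.map Z) q} :=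
        fun ω hω => monotone_cdf _ hω
      have hd := measureReal_sdiff (μ := P) hsub (measurableSet_le hZ measurable_const)
      rw [measureReal_cdf_le hZ hc hq, ← cdf_map_eq hZ, sub_self, measureReal_eq_zero_iff,
        measure_eq_zero_iff_ae_notMem] at hd
      filter_upwards [hd] with ω hω _ h2
      by_contra h3
      exact hω ⟨h2, h3⟩
    · rcases (cdf_nonneg (P.map Z) q).eq_or_lt with h0 | h0
      · refine ae_of_all _ fun ω h1 h2 => ?_
        exact absurd (h1.1.trans_le h2) (by rw [← h0]; exact lt_irrefl _)
      · have h1 : cdf (P.map Z) q = 1 := by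
          by_contra hne
          exact hq ⟨h0, (cdf_le_one _ _).lt_of_ne hne⟩
        rw [cdf_map_eq hZ] at h1
        have hcompl := probReal_compl_eq_one_sub (μ := P)
          (s := {ω | Z ω ≤ q}) (measurableSet_le hZ measurable_const)
        rw [h1, sub_self, measureReal_eq_zero_iff, measure_eq_zero_iff_ae_notMem] at hcompl
        filter_upwards [hcompl] with ω hω _ _
        exact not_not.1 hω
  filter_upwards [ae_all_iff.2 hflat, ae_cdf_mem_Ioo hZ hc] with ω h1 h2
  by_contra! hlt
  obtain ⟨q, hq1, hq2⟩ := exists_rat_btwn hlt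
  rw [unitQuantile, indicator_of_mem h2] at hq1
  exact absurd (h1 q h2 (((quantile_le_iff _ h2).1 hq1.le).trans (hle q))) (not_le.2 hq2)

/-- Continuity of the cdf makes `F(Z)` uniform, so the increment can be a function of `Z` and no
extra randomness is needed. The `max` makes it nonnegative everywhere and changes it only on a null
set. -/
theorem exists_monotone_coupling (hZ : Measurable Z) (hc : Continuous (cdf (P.map Z)))
    (hY : Measurable Y) (hle : ∀ t, cdf (P'.map Y) t ≤ cdf (P.map Z) t) :
    ∃ w : ℝ → ℝ, Measurable w ∧ (∀ z, 0 ≤ w z) ∧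
      IdentDistrib Y (fun ω => Z ω + w (Z ω)) P' P := by
  have hm : Measurable fun z => unitQuantile (P'.map Y) (cdf (P.map Z) z) :=
    (measurable_unitQuantile _).comp hc.measurable
  refine ⟨fun z => max (unitQuantile (P'.map Y) (cdf (P.map Z) z) - z) 0, by fun_prop,
    fun z => le_max_right _ _, ?_⟩
  refine (identDistrib_unitQuantile_cdf hZ hc hY).trans
    (IdentDistrib.of_ae_eq (hm.comp hZ).aemeasurable ?_)
  filter_upwards [ae_le_unitQuantile_cdf hZ hc hle] with ω hω
  rw [max_eq_left (by linarith)]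
  ring

end Quantile

/-! ### Symmetric laws and their absolute values -/

section Symmetric

theorem leftLim_eq_of_continuous {f : ℝ → ℝ} (hf : Continuous f) (x : ℝ) :
    Function.leftLim f x = f x :=
  leftLim_eq_of_tendsto (hf.continuousAt.mono_left nhdsWithin_le_nhds)

variable {Ω : Type*} [MeasurableSpace Ω] {P : Measure Ω} {N : Ω → ℝ}

theorem cdf_map_abs [IsProbabilityMeasure P] (hN : Measurable N) (hc : Continuous (cdf (P.map N)))
    (hs : ∀ x, cdf (P.map N) x = 1 - cdf (P.map N) (-x)) (t : ℝ) :
    cdf (P.map fun ω => |N ω|) t = 2 * cdf (P.map N) (max t 0) - 1 := by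
  have := Measure.isProbabilityMeasure_map (μ := P) hN.aemeasurable
  rw [cdf_map_eq (by fun_prop)]
  rcases lt_or_ge t 0 with ht | ht
  · have h0 : {ω | |N ω| ≤ t} = ∅ :=
      eq_empty_of_forall_notMem fun ω hω => absurd ((abs_nonneg _).trans hω) (not_le.2 ht)
    have := hs 0
    rw [neg_zero] at this
    rw [h0, max_eq_right ht.le, measureReal_empty]
    linarith
  · have h1 : {ω | |N ω| ≤ t} = N ⁻¹' Icc (-t) t :=
      Set.ext fun ω => abs_le (a := N ω)
    rw [h1, ← map_measureReal_apply hN measurableSet_Icc, measureReal_def]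
    conv_lhs => rw [← measure_cdf (P.map N)]
    have hmono := monotone_cdf (P.map N) (show -t ≤ t by linarith)
    rw [StieltjesFunction.measure_Icc, leftLim_eq_of_continuous hc,
      ENNReal.toReal_ofReal (by linarith), max_eq_left ht]
    linarith [hs t]

theorem identDistrib_neg [IsProbabilityMeasure P] (hN : Measurable N) (hc : Continuous (cdf (P.map N)))
    (hs : ∀ x, cdf (P.map N) x = 1 - cdf (P.map N) (-x)) :
    IdentDistrib N (fun ω => -N ω) P P := by
  refine ⟨hN.aemeasurable, hN.neg.aemeasurable, ?_⟩
  have := Measure.isProbabilityMeasure_map (μ := P) hN.aemeasurable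
  have hN' : Measurable fun ω => -N ω := hN.neg
  have := Measure.isProbabilityMeasure_map (μ := P) hN'.aemeasurable
  refine Measure.eq_of_cdf _ _ (StieltjesFunction.ext fun x => ?_)
  rw [cdf_map_eq hN']
  have h1 : {ω | -N ω ≤ x} = N ⁻¹' Ici (-x) :=
    Set.ext fun ω => neg_le (a := N ω)
  rw [h1, ← map_measureReal_apply hN measurableSet_Ici, measureReal_def]
  conv_rhs => rw [← measure_cdf (P.map N)]
  rw [StieltjesFunction.measure_Ici _ (tendsto_cdf_atTop _), leftLim_eq_of_continuous hc,
    ENNReal.toReal_ofReal (sub_nonneg.2 (cdf_le_one _ _)), hs x]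

/-- Averaging over `N` and `-N` leaves an integrand that depends on `|N|` alone, so the law of `|N|`
determines that of `N`. -/
theorem two_mul_measure_preimage_of_symmetric (hN : Measurable N)
    (hs : IdentDistrib N (fun ω => -N ω) P P) {A : Set ℝ} (hA : MeasurableSet A) :
    2 * P (N ⁻¹' A) = ∫⁻ ω, (A.indicator 1 |N ω| + A.indicator 1 (-|N ω|)) ∂P := by
  have hi : Measurable (A.indicator (1 : ℝ → ENNReal)) := measurable_one.indicator hA
  have h1 : P (N ⁻¹' A) = ∫⁻ ω, A.indicator 1 (N ω) ∂P := by
    rw [← lintegral_map hi hN, lintegral_indicator_one hA, Measure.map_apply hN hA]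
  have h2 : ∫⁻ ω, A.indicator 1 (N ω) ∂P = ∫⁻ ω, A.indicator 1 (-N ω) ∂P :=
    (hs.comp hi).lintegral_eq
  rw [two_mul]
  conv_lhs => rw [h1]
  conv_lhs => enter [2]; rw [h2]
  have hiN : Measurable fun ω => A.indicator (1 : ℝ → ENNReal) (N ω) := hi.comp hN
  rw [← lintegral_add_left hiN]
  refine lintegral_congr fun ω => ?_
  rcases le_total 0 (N ω) with h | h
  · rw [abs_of_nonneg h]
  · rw [abs_of_nonpos h, neg_neg, add_comm]

theorem identDistrib_of_identDistrib_abs {Ω' : Type*} [MeasurableSpace Ω'] {P' : Measure Ω'}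
    {X : Ω' → ℝ} (hX : Measurable X) (hN : Measurable N)
    (hXs : IdentDistrib X (fun ω => -X ω) P' P') (hNs : IdentDistrib N (fun ω => -N ω) P P)
    (habs : IdentDistrib (fun ω => |X ω|) (fun ω => |N ω|) P' P) : IdentDistrib X N P' P := by
  refine ⟨hX.aemeasurable, hN.aemeasurable, Measure.ext fun A hA => ?_⟩
  rw [Measure.map_apply hX hA, Measure.map_apply hN hA]
  have hi : Measurable (A.indicator (1 : ℝ → ENNReal)) := measurable_one.indicator hA
  have h : 2 * P' (X ⁻¹' A) = 2 * P (N ⁻¹' A) := by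
    rw [two_mul_measure_preimage_of_symmetric hX hXs hA,
      two_mul_measure_preimage_of_symmetric hN hNs hA]
    exact (habs.comp (u := fun r => A.indicator (1 : ℝ → ENNReal) r + A.indicator 1 (-r))
      (hi.add (hi.comp measurable_neg))).lintegral_eq
  exact (ENNReal.mul_right_inj two_ne_zero ENNReal.ofNat_ne_top).1 h

theorem measurable_sign : Measurable Real.sign :=
  Measurable.ite measurableSet_Iio measurable_const
    (Measurable.ite measurableSet_Ioi measurable_const measurable_const)

theorem abs_add_sign_mul {x r : ℝ} (hx : x ≠ 0) (hr : 0 ≤ r) :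
    |x + Real.sign x * r| = |x| + r := by
  rcases hx.lt_or_gt with h | h
  · rw [Real.sign_of_neg h, abs_of_neg h, abs_of_nonpos (by linarith)]; ring
  · rw [Real.sign_of_pos h, abs_of_pos h, abs_of_nonneg (by linarith)]; ring

theorem identDistrib_add_sign_mul {Ω' : Type*} [MeasurableSpace Ω'] {P' : Measure Ω'}
    {X : Ω' → ℝ} (hX : Measurable X) (hN : Measurable N)
    (hXs : IdentDistrib X (fun ω => -X ω) P' P') (hNs : IdentDistrib N (fun ω => -N ω) P P)
    (hN0 : ∀ᵐ ω ∂P, N ω ≠ 0) {w : ℝ → ℝ} (hw : Measurable w) (hw0 : ∀ z, 0 ≤ w z)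
    (habs : IdentDistrib (fun ω => |X ω|) (fun ω => |N ω| + w |N ω|) P' P) :
    IdentDistrib X (fun ω => N ω + Real.sign (N ω) * w |N ω|) P' P := by
  have hg : Measurable fun x : ℝ => x + Real.sign x * w |x| :=
    measurable_id.add (measurable_sign.mul (hw.comp measurable_id.abs))
  refine identDistrib_of_identDistrib_abs hX (hg.comp hN) hXs ?_ (habs.trans ?_)
  · have h := hNs.comp hg
    have e : (fun x : ℝ => x + Real.sign x * w |x|) ∘ (fun ω => -N ω) =
        fun ω => -(N ω + Real.sign (N ω) * w |N ω|) := by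
      funext ω
      simp only [Function.comp_apply, Real.sign_neg, abs_neg]
      ring
    rwa [e] at h
  · refine IdentDistrib.of_ae_eq (hN.abs.add (hw.comp hN.abs)).aemeasurable ?_
    filter_upwards [hN0] with ω hω
    exact (abs_add_sign_mul hω (hw0 _)).symm

end Symmetric

/-! ### Expectations of monotone functions under a coupling -/

section Monotone

variable {Ω : Type*} [MeasurableSpace Ω] {P : Measure Ω}
  {Ω' : Type*} [MeasurableSpace Ω'] {P' : Measure Ω'}

theorem extExpectation_mono {X Y : Ω → ℝ} (h : ∀ ω, X ω ≤ Y ω) :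
    extExpectation P X ≤ extExpectation P Y :=
  EReal.sub_le_sub
    (EReal.coe_ennreal_le_coe_ennreal_iff.2
      (lintegral_mono fun ω => ENNReal.ofReal_le_ofReal (h ω)))
    (EReal.coe_ennreal_le_coe_ennreal_iff.2
      (lintegral_mono fun ω => ENNReal.ofReal_le_ofReal (neg_le_neg (h ω))))

theorem extExpectation_congr {X : Ω → ℝ} {Y : Ω' → ℝ} (h : IdentDistrib X Y P P') :
    extExpectation P X = extExpectation P' Y := by
  have h1 := (h.comp ENNReal.measurable_ofReal).lintegral_eq
  have h2 := (h.comp (ENNReal.measurable_ofReal.comp measurable_neg)).lintegral_eq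
  simp only [Function.comp_def] at h1 h2
  rw [extExpectation, extExpectation, h1, h2]

theorem expectation_le_of_coupling [IsProbabilityMeasure P] {φ : ℝ → ℝ} (hφ : MonotoneOn φ (Ici 0)) {Z V : Ω → ℝ}
    (hZ : Measurable Z) (hZ0 : ∀ ω, 0 ≤ Z ω) (hV0 : ∀ ω, 0 ≤ V ω) {Y : Ω' → ℝ}
    (hY0 : ∀ ω, 0 ≤ Y ω) (h : IdentDistrib Y (fun ω => Z ω + V ω) P' P) :
    extExpectation P (fun ω => φ (Z ω)) ≤ extExpectation P' (fun ω => φ (Y ω)) ∧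
      (Integrable (fun ω => φ (Y ω)) P' → Integrable (fun ω => φ (Z ω)) P ∧
        ∫ ω, φ (Z ω) ∂P ≤ ∫ ω, φ (Y ω) ∂P') := by
  -- `φ` is arbitrary on the negative axis; truncating its argument gives a function monotone on all
  -- of `ℝ`, hence measurable.
  have hψ : Measurable fun x => φ (max x 0) :=
    Monotone.measurable fun x y hxy =>
      hφ (le_max_right x 0) (le_max_right y 0) (max_le_max_right 0 hxy)
  have hid : IdentDistrib (fun ω => φ (Y ω)) (fun ω => φ (Z ω + V ω)) P' P := by
    have := h.comp hψ
    have e1 : (fun x => φ (max x 0)) ∘ Y = fun ω => φ (Y ω) := by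
      funext ω; simp [hY0 ω]
    have e2 : (fun x => φ (max x 0)) ∘ (fun ω => Z ω + V ω) = fun ω => φ (Z ω + V ω) := by
      funext ω; simp [add_nonneg (hZ0 ω) (hV0 ω)]
    rwa [e1, e2] at this
  have hφZ : Measurable fun ω => φ (Z ω) := by
    have := hψ.comp hZ
    have e : (fun x => φ (max x 0)) ∘ Z = fun ω => φ (Z ω) := by
      funext ω; simp [hZ0 ω]
    rwa [e] at this
  have hle : ∀ ω, φ (Z ω) ≤ φ (Z ω + V ω) := fun ω =>
    hφ (hZ0 ω) (add_nonneg (hZ0 ω) (hV0 ω)) (le_add_of_nonneg_right (hV0 ω))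
  refine ⟨(extExpectation_mono hle).trans (extExpectation_congr hid).ge, fun hint => ?_⟩
  have hint' := hid.integrable_snd hint
  have hintZ : Integrable (fun ω => φ (Z ω)) P :=
    integrable_of_le_of_le hφZ.aestronglyMeasurable
      (ae_of_all _ fun ω => hφ self_mem_Ici (hZ0 ω) (hZ0 ω)) (ae_of_all _ hle)
      (integrable_const (φ 0)) hint'
  exact ⟨hintZ, (integral_mono hintZ hint' hle).trans hid.integral_eq.ge⟩

end Monotone

/-- Shifting by `2s > 2t` moves the interval past its own right end, so its mass plus that of `X +
2s ≤ a + t` is at most `u`. Working with `s > t` keeps these events disjoint and covers `t = 0`;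
continuity of `F` then recovers `t`. -/
theorem measureReal_abs_sub_le {f : ℝ → ℝ → ℝ} (hf : IsInfinitelyDivisible f) {F : ℝ → ℝ}
    (hF : ∀ x, Tendsto (fun s => constructedCDF (f s) (x / s)) (𝓝[>] 0) (𝓝 (F x)))
    (hFc : Continuous F) {Ω : Type*} [MeasurableSpace Ω] (P : Measure Ω) [IsProbabilityMeasure P]
    {X : Ω → ℝ} (hX : Measurable X)
    (hpriv : ∀ t : ℝ, 0 ≤ t → ∀ α ∈ Icc (0 : ℝ) 1,
      f t α ≤ tradeoff (P.map X) (P.map (fun ω => X ω + t)) α) (a : ℝ) {t : ℝ} (ht : 0 ≤ t) :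
    P.real {ω | |X ω - a| ≤ t} ≤ 2 * F t - 1 := by
  have hbound : ∀ s, t < s → P.real {ω | |X ω - a| ≤ t} ≤ 2 * F s - 1 := by
    intro s hs
    have hs0 : 0 < s := ht.trans_lt hs
    have hXs : Measurable fun ω => X ω + 2 * s := hX.add_const _
    have := Measure.isProbabilityMeasure_map (μ := P) hX.aemeasurable
    have := Measure.isProbabilityMeasure_map (μ := P) hXs.aemeasurable
    have hm : MeasurableSet (Ioi (a + t)) := measurableSet_Ioi
    have htest {Y : Ω → ℝ} (hY : Measurable Y) :
        ∫ y, (Ioi (a + t)).indicator 1 y ∂(P.map Y) = 1 - P.real {ω | Y ω ≤ a + t} := by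
      rw [integral_indicator_one hm, map_measureReal_apply hY hm,
        ← probReal_compl_eq_one_sub (measurableSet_le hY measurable_const)]
      congr 1
      ext ω
      simp
    have hu : P.real {ω | X ω ≤ a + t} ∈ Icc (0 : ℝ) 1 := ⟨measureReal_nonneg, measureReal_le_one⟩
    have h1 := tradeoff_le (P := P.map X) (Q := P.map fun ω => X ω + 2 * s)
      (φ := (Ioi (a + t)).indicator 1) (α := P.real {ω | X ω ≤ a + t})
      (measurable_one.indicator hm)
      (fun y => ⟨indicator_nonneg (fun _ _ => zero_le_one) y,
        indicator_le_self' (fun _ _ => zero_le_one) y⟩) (htest hX).le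
    rw [htest hXs, sub_sub_cancel] at h1
    have h2 := hpriv (2 * s) (by linarith) _ hu
    have h3 := hf.sub_le_of_isLimit hF hs0 hu
    have hd : Disjoint {ω | |X ω - a| ≤ t} {ω | X ω + 2 * s ≤ a + t} := by
      refine Set.disjoint_left.2 fun ω h h' => ?_
      have h : |X ω - a| ≤ t := h
      have h' : X ω + 2 * s ≤ a + t := h'
      linarith [(abs_le.1 h).1]
    have h4 := measureReal_union (μ := P) hd (measurableSet_le hXs measurable_const)
    have h5 : P.real ({ω | |X ω - a| ≤ t} ∪ {ω | X ω + 2 * s ≤ a + t}) ≤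
        P.real {ω | X ω ≤ a + t} := by
      refine measureReal_mono ?_
      rintro ω (h | h)
      · have h : |X ω - a| ≤ t := h
        change X ω ≤ a + t
        linarith [(abs_le.1 h).2]
      · have h : X ω + 2 * s ≤ a + t := h
        change X ω ≤ a + t
        linarith
    linarith
  have hlim : Tendsto (fun s => 2 * F s - 1) (𝓝[>] t) (𝓝 (2 * F t - 1)) :=
    (Continuous.tendsto (by fun_prop) t).mono_left nhdsWithin_le_nhds
  refine ge_of_tendsto hlim ?_
  filter_upwards [self_mem_nhdsWithin] with s hs using hbound s hs

end CanonicalNoise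

end

theorem theorem4p9
    {f : ℝ → ℝ → ℝ} (hf : CanonicalNoise.IsInfinitelyDivisible f)
    {Ω : Type*} [MeasurableSpace Ω] (P : Measure Ω) [IsProbabilityMeasure P]
    {N : Ω → ℝ} (hN : Measurable N)
    (hCND : CanonicalNoise.IsLogConcaveCND (P.map N) f)
    {Ω' : Type*} [MeasurableSpace Ω'] (P' : Measure Ω') [IsProbabilityMeasure P']
    {N' : Ω' → ℝ} (hN' : Measurable N')
    (hpriv : ∀ t : ℝ, 0 ≤ t → ∀ α ∈ Icc (0 : ℝ) 1,
      f t α ≤ CanonicalNoise.tradeoff (P'.map N') (P'.map (fun ω => N' ω + t)) α) :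
    (∀ a : ℝ, CanonicalNoise.StochasticallyDominates
      (P'.map (fun ω => |N' ω - a|)) (P.map (fun ω => |N ω|))) ∧
    (∀ a t : ℝ, 0 ≤ t →
      P'.real {ω | |N' ω - a| ≤ t} ≤ P.real {ω | |N ω| ≤ t}) ∧
    (∀ φ : ℝ → ℝ, MonotoneOn φ (Ici 0) → ∀ a : ℝ,
      CanonicalNoise.extExpectation P (fun ω => φ |N ω|) ≤
          CanonicalNoise.extExpectation P' (fun ω => φ |N' ω - a|) ∧
        (Integrable (fun ω => φ |N' ω - a|) P' →
          Integrable (fun ω => φ |N ω|) P ∧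
            ∫ ω, φ |N ω| ∂P ≤ ∫ ω, φ |N' ω - a| ∂P')) ∧
    (∃ W : Ω → ℝ, Measurable W ∧ (∀ ω, 0 ≤ W ω) ∧
      IdentDistrib (fun ω => |N' ω|) (fun ω => |N ω| + W ω) P' P ∧
      (IdentDistrib N' (fun ω => -N' ω) P' P' →
        IdentDistrib N' (fun ω => N ω + Real.sign (N ω) * W ω) P' P)) := by
  have hc := hCND.isCND.continuous_cdf
  have hs := hCND.isCND.symmetric
  have habs := CanonicalNoise.cdf_map_abs hN hc hs
  have hle (a t : ℝ) (ht : 0 ≤ t) :=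
    CanonicalNoise.measureReal_abs_sub_le hf hCND.isLimit hc P' hN' hpriv a ht
  have hm (a : ℝ) : Measurable fun ω => |N' ω - a| := (hN'.sub_const a).abs
  have hdom (a : ℝ) : CanonicalNoise.StochasticallyDominates
      (P'.map (fun ω => |N' ω - a|)) (P.map (fun ω => |N ω|)) := by
    intro t
    rcases lt_or_ge t 0 with ht | ht
    · rw [CanonicalNoise.cdf_map_eq (hm a)]
      have h0 : {ω | |N' ω - a| ≤ t} = ∅ :=
        eq_empty_of_forall_notMem fun ω hω => absurd ((abs_nonneg _).trans hω) (not_le.2 ht)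
      rw [h0, measureReal_empty]
      exact cdf_nonneg _ _
    · rw [CanonicalNoise.cdf_map_eq (hm a), habs, max_eq_left ht]
      exact hle a t ht
  have hcabs : Continuous (cdf (P.map fun ω => |N ω|)) := by
    have e : (cdf (P.map fun ω => |N ω|) : ℝ → ℝ) =
        fun t => 2 * cdf (P.map N) (max t 0) - 1 := funext habs
    rw [e]
    fun_prop
  have hcoup (a : ℝ) :=
    CanonicalNoise.exists_monotone_coupling hN.abs hcabs (hm a) (hdom a)
  refine ⟨hdom, fun a t ht => ?_, fun φ hφ a => ?_, ?_⟩
  · have h := hdom a t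
    rwa [CanonicalNoise.cdf_map_eq (hm a), CanonicalNoise.cdf_map_eq hN.abs] at h
  · obtain ⟨w, -, hw0, hid⟩ := hcoup a
    exact CanonicalNoise.expectation_le_of_coupling hφ hN.abs (fun _ => abs_nonneg _)
      (fun _ => hw0 _) (fun _ => abs_nonneg _) hid
  · obtain ⟨w, hw, hw0, hid⟩ := hcoup 0
    simp only [sub_zero] at hid
    refine ⟨fun ω => w |N ω|, hw.comp hN.abs, fun _ => hw0 _, hid, fun hsym => ?_⟩
    -- `Real.sign 0 = 0` would discard `W` at the origin, so that point must be null; `F(0) = 1/2`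
    -- shows that it is.
    have hN0 : ∀ᵐ ω ∂P, N ω ≠ 0 := by
      have h := habs 0
      have h0 := hs 0
      rw [neg_zero] at h0
      rw [CanonicalNoise.cdf_map_eq hN.abs, max_self,
        show 2 * cdf (P.map N) 0 - 1 = 0 by linarith, measureReal_eq_zero_iff,
        measure_eq_zero_iff_ae_notMem] at h
      filter_upwards [h] with ω hω h1
      exact hω (by simp [h1])
    exact CanonicalNoise.identDistrib_add_sign_mul hN' hN hsym
      (CanonicalNoise.identDistrib_neg hN hc hs) hN0 hw hw0 hid
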